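/- Let $d\in\{1,2,3\}$, let $\mathscr D\subset\mathbb R^d$ be a bounded open set, and let $\mathcal T_h$ be a conforming triangulation of $\overline{\mathscr D}$ into finitely many $d$-simplices (intervals, triangles, tetrahedra; the elements may be curved, that is, $\mathcal T_h$ is the image of a finite pure $d$-dimensional simplicial complex under a homeomorphism of its underlying space onto $\overline{\mathscr D}$ that is a $C^1$ diffeomorphism on each closed $d$-simplex; this homeomorphism is the identity if the elements are straight). For $r\ge 1$ let $$\mathbb V_h=\{\phi\in C(\overline{\mathscr D};\mathbb R^3):\ \phi|_K \text{ is a polynomial of degree at most } r \text{ for every } K\in\mathcal T_h\}.$$ Write $\langle\cdot,\cdot\rangle$ for the $L^2(\mathscr D)$ scalar product of vector- or matrix-valued functions. Let $P_h:L^2(\mathscr D;\mathbb R^3)\to\mathbb V_h$ be the $L^2$-orthogonal projection, $\langle P_hf-f,\chi\rangle=0$ for all $\chi\in\mathbb V_h$, and let $\Delta_h:\mathbb V_h\to\mathbb V_h$ be the discrete Laplacian, $\langle\Delta_h v,\chi\rangle=-\langle\nabla v,\nabla\chi\rangle$ for all $\chi\in\mathbb V_h$. Let $\alpha>0$, $\beta_1\in\mathbb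 R$, and let $e\in\mathbb R^3$ be a unit vector. **Lemma 5.3.** Let $k>0$, $n\ge 1$, $t_n=nk$, let $u_h^{n-1}\in\mathbb V_h$, and let $\nu$ be a current density with values in $\mathbb R^d$ such that $\nu^n:=\nu(t_n,\cdot)$ is measurable and $|\nu^n|\le\nu_\infty$ almost everywhere in $\mathscr D$, for some constant $\nu_\infty$. Then there exists $u_h^n\in\mathbb V_h$ such that for all $\chi\in\mathbb V_h$ $$\Big\langle \frac{u_h^n-u_h^{n-1}}{k},\chi\Big\rangle=-\langle u_h^n\times H_h^n,\chi\rangle+\alpha\langle H_h^n,\chi\rangle+\beta_1\langle(\nu^n\cdot\nabla)u_h^{n-1},\chi\rangle,$$ where $$H_h^n:=\Delta_hu_h^n-u_h^n-P_h\big(|u_h^n|^2u_h^n\big)-e\,(e\cdot u_h^n).$$ -/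

import Mathlib

open MeasureTheory Set Topology

noncomputable section

namespace LLB

/-- The Euclidean space `ℝⁿ` (Euclidean norm and inner product). -/
abbrev Eu (n : ℕ) : Type := EuclideanSpace ℝ (Fin n)

/-- The vector product of `ℝ³`. -/
def cross (a b : Eu 3) : Eu 3 := WithLp.toLp 2 (crossProduct a.ofLp b.ofLp)

/-- A conforming triangulation of (the closure of) `D ⊆ ℝᵈ` into `d`-simplices: a finite, pure
`d`-dimensional simplicial complex together with a homeomorphism `chart` of its underlying space
onto `closure D` which is a `C¹` diffeomorphism on each closed `d`-simplex.
For a polyhedral `D` one takes `chart = id`, and the elements are straight intervals, triangles or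
tetrahedra; a nontrivial `chart` gives the curved elements that are needed if `D` has a smooth
boundary. (`chart` is only relevant on the underlying space.) -/
structure Triangulation {d : ℕ} (D : Set (Eu d)) where
  complex : Geometry.SimplicialComplex ℝ (Eu d)
  finite : complex.faces.Finite
  pure : ∀ s ∈ complex.faces, ∃ t ∈ complex.faces, s ⊆ t ∧ t.card = d + 1
  chart : Eu d → Eu d
  chart_continuousOn : ContinuousOn chart complex.space
  chart_injOn : InjOn chart complex.space
  chart_image : chart '' complex.space = closure D
  chart_contDiffOn : ∀ s ∈ complex.faces, s.card = d + 1 →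
    ContDiffOn ℝ 1 chart (convexHull ℝ (s : Set (Eu d)))
  chart_immersion : ∀ s ∈ complex.faces, s.card = d + 1 → ∀ x ∈ convexHull ℝ (s : Set (Eu d)),
    Function.Injective (fderivWithin ℝ chart (convexHull ℝ (s : Set (Eu d))) x)

variable {d : ℕ} {D : Set (Eu d)}

/-- The set of (closed) elements of a triangulation. -/
def Triangulation.elements (𝒯 : Triangulation D) : Set (Set (Eu d)) :=
  {K | ∃ s ∈ 𝒯.complex.faces, s.card = d + 1 ∧
    K = 𝒯.chart '' convexHull ℝ (s : Set (Eu d))}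

/-- `v` is on `K` an `ℝ³`-valued polynomial of degree at most `r`. -/
def IsPolyOn (r : ℕ) (K : Set (Eu d)) (v : Eu d → Eu 3) : Prop :=
  ∃ p : Fin 3 → MvPolynomial (Fin d) ℝ, (∀ i, (p i).totalDegree ≤ r) ∧
    ∀ x ∈ K, ∀ i, v x i = MvPolynomial.eval (fun j => x j) (p i)

/-- The finite element space `V_h` of continuous functions `closure D → ℝ³` that are polynomials of
degree at most `r` on each element. A function on `closure D` is represented by its extension by
zero to `ℝᵈ`; nothing below depends on the values outside of `closure D`. -/
def Vh (𝒯 : Triangulation D) (r : ℕ) : Submodule ℝ (Eu d → Eu 3) where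
  carrier := {v | ContinuousOn v (closure D) ∧ (∀ x ∉ closure D, v x = 0) ∧
    ∀ K ∈ 𝒯.elements, IsPolyOn r K v}
  zero_mem' := ⟨continuousOn_const, fun _ _ => rfl, fun _ _ =>
    ⟨fun _ => 0, fun _ => by simp, fun _ _ _ => by simp⟩⟩
  add_mem' := by
    rintro v w ⟨hv, hv0, hvp⟩ ⟨hw, hw0, hwp⟩
    refine ⟨hv.add hw, fun x hx => by simp [hv0 x hx, hw0 x hx], fun K hK => ?_⟩
    obtain ⟨p, hp, hpe⟩ := hvp K hK
    obtain ⟨q, hq, hqe⟩ := hwp K hK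
    exact ⟨fun i => p i + q i,
      fun i => (MvPolynomial.totalDegree_add _ _).trans (max_le (hp i) (hq i)),
      fun x hx i => by simp [hpe x hx i, hqe x hx i]⟩
  smul_mem' := by
    rintro c v ⟨hv, hv0, hvp⟩
    refine ⟨hv.const_smul c, fun x hx => by simp [hv0 x hx], fun K hK => ?_⟩
    obtain ⟨p, hp, hpe⟩ := hvp K hK
    exact ⟨fun i => c • p i, fun i => (MvPolynomial.totalDegree_smul_le _ _).trans (hp i),
      fun x hx i => by simp [hpe x hx i]⟩

/-- The scalar product of `L²(D; ℝ³)`. -/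
def l2 (D : Set (Eu d)) (f g : Eu d → Eu 3) : ℝ := ∫ x in D, inner ℝ (f x) (g x)

/-- The partial derivative in the `i`-th coordinate direction. An element of `V_h` is a polynomial
on each element, so this exists in `D` off the null set of element boundaries, and there it agrees
with the weak partial derivative of the (locally Lipschitz) function. -/
def pd (i : Fin d) (f : Eu d → Eu 3) (x : Eu d) : Eu 3 :=
  fderiv ℝ f x (EuclideanSpace.single i 1)

/-- The scalar product `⟨∇f, ∇g⟩` of `L²(D; ℝ^{3×d})`. -/
def l2Grad (D : Set (Eu d)) (f g : Eu d → Eu 3) : ℝ :=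
  ∫ x in D, ∑ i, inner ℝ (pd i f x) (pd i g x)

/-- The directional derivative `(b · ∇) f = ∑ i, bᵢ ∂ᵢ f` along a vector field `b`. -/
def advect (b : Eu d → Eu d) (f : Eu d → Eu 3) (x : Eu d) : Eu 3 := ∑ i, b x i • pd i f x

/-- The `L²(D)`-orthogonal projection `P_h : L²(D; ℝ³) → V_h`: the unique element with
`⟨P_h f - f, χ⟩ = 0` for all `χ ∈ V_h` (see `l2Proj_spec` and `eq_l2Proj`). -/
def l2Proj (𝒯 : Triangulation D) (r : ℕ) (f : Eu d → Eu 3) : Vh 𝒯 r :=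
  Classical.epsilon fun p : Vh 𝒯 r => ∀ χ : Vh 𝒯 r, l2 D (fun x => p.1 x - f x) χ.1 = 0

/-- The discrete Laplacian `Δ_h : V_h → V_h`: the unique element with
`⟨Δ_h v, χ⟩ = -⟨∇v, ∇χ⟩` for all `χ ∈ V_h` (see `discLap_spec` and `eq_discLap`). -/
def discLap (𝒯 : Triangulation D) (r : ℕ) (v : Vh 𝒯 r) : Vh 𝒯 r :=
  Classical.epsilon fun p : Vh 𝒯 r => ∀ χ : Vh 𝒯 r, l2 D p.1 χ.1 = -l2Grad D v.1 χ.1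

/-- The lower-order part `w_h = u + P_h(|u|² u) + e (e · u)` of the discrete effective field. -/
def lowerField (𝒯 : Triangulation D) (r : ℕ) (e : Eu 3) (u : Vh 𝒯 r) (x : Eu d) : Eu 3 :=
  u.1 x + (l2Proj 𝒯 r fun y => ‖u.1 y‖ ^ 2 • u.1 y).1 x + inner ℝ e (u.1 x) • e

/-- The discrete effective field `H_h = Δ_h u - w_h`. -/
def effField (𝒯 : Triangulation D) (r : ℕ) (e : Eu 3) (u : Vh 𝒯 r) (x : Eu d) : Eu 3 :=
  (discLap 𝒯 r u).1 x - lowerField 𝒯 r e u x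

/-- One step of the implicit scheme: `u = u_hⁿ` solves, with `uprev = u_hⁿ⁻¹` and `b = νⁿ`,
`⟨(u - uprev)/k, χ⟩ = -⟨u × H_h, χ⟩ + α ⟨H_h, χ⟩ + β₁ ⟨(b · ∇) uprev, χ⟩` for all `χ ∈ V_h`. -/
def SolvesStep (𝒯 : Triangulation D) (r : ℕ) (e : Eu 3) (α β₁ k : ℝ) (b : Eu d → Eu d)
    (uprev u : Vh 𝒯 r) : Prop :=
  ∀ χ : Vh 𝒯 r,
    l2 D (fun x => k⁻¹ • (u.1 x - uprev.1 x)) χ.1 =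
      -l2 D (fun x => cross (u.1 x) (effField 𝒯 r e u x)) χ.1
        + α * l2 D (effField 𝒯 r e u) χ.1
        + β₁ * l2 D (advect b uprev.1) χ.1

/-! ### The projection and the discrete Laplacian are well defined -/

section WellDefined

variable {𝒯 : Triangulation D} {r : ℕ}

lemma isCompact_closure (𝒯 : Triangulation D) : IsCompact (closure D) := by
  rw [← 𝒯.chart_image]
  refine IsCompact.image_of_continuousOn ?_ 𝒯.chart_continuousOn
  unfold Geometry.SimplicialComplex.space
  exact 𝒯.finite.isCompact_biUnion fun s _ => s.finite_toSet.isCompact_convexHull ℝ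

lemma closure_eq_iUnion (𝒯 : Triangulation D) {x : Eu d} (hx : x ∈ closure D) :
    ∃ s ∈ 𝒯.complex.faces, s.card = d + 1 ∧
      x ∈ 𝒯.chart '' convexHull ℝ (s : Set (Eu d)) := by
  rw [← 𝒯.chart_image] at hx
  obtain ⟨y, hy, rfl⟩ := hx
  obtain ⟨s, hs, hys⟩ := Geometry.SimplicialComplex.mem_space_iff.1 hy
  obtain ⟨t, ht, hst, hc⟩ := 𝒯.pure s hs
  exact ⟨t, ht, hc, mem_image_of_mem _ (convexHull_mono (by exact_mod_cast hst) hys)⟩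

instance : FiniteDimensional ℝ (Vh 𝒯 r) := by
  classical
  let F := {s : Finset (Eu d) // s ∈ 𝒯.complex.faces}
  have : Finite F := 𝒯.finite
  let P := MvPolynomial.restrictTotalDegree (Fin d) ℝ r
  let K : F → Set (Eu d) := fun s => 𝒯.chart '' convexHull ℝ (s.1 : Set (Eu d))
  -- evaluation of piecewise polynomials, and restriction of elements of `V_h`
  let ev : (F → Fin 3 → P) →ₗ[ℝ] ((s : F) → K s → Fin 3 → ℝ) :=
    { toFun := fun p s x i => MvPolynomial.eval (fun j => x.1 j) (p s i).1
      map_add' := fun p q => by ext; simp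
      map_smul' := fun c p => by ext; simp }
  let res : Vh 𝒯 r →ₗ[ℝ] ((s : F) → K s → Fin 3 → ℝ) :=
    { toFun := fun v s x i => if s.1.card = d + 1 then v.1 x.1 i else 0
      map_add' := fun p q => by ext s x i; by_cases h : s.1.card = d + 1 <;> simp [h]
      map_smul' := fun c p => by ext s x i; by_cases h : s.1.card = d + 1 <;> simp [h] }
  have hle : LinearMap.range res ≤ LinearMap.range ev := by
    rintro _ ⟨v, rfl⟩
    have : ∀ s : F, ∃ p : Fin 3 → P, ∀ (x : K s) (i : Fin 3),
        MvPolynomial.eval (fun j => x.1 j) (p i).1 = res v s x i := by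
      intro s
      by_cases h : s.1.card = d + 1
      · obtain ⟨p, hp, hpe⟩ := v.2.2.2 (K s) ⟨s.1, s.2, h, rfl⟩
        refine ⟨fun i => ⟨p i, (MvPolynomial.mem_restrictTotalDegree _ _ _).2 (hp i)⟩, ?_⟩
        intro x i
        simp [res, h, hpe x.1 x.2 i]
      · exact ⟨0, fun x i => by simp [res, h]⟩
    choose p hp using this
    exact ⟨p, by ext s x i; exact hp s x i⟩
  have hinj : Function.Injective res := by
    intro v w h
    apply Subtype.ext
    funext x
    by_cases hx : x ∈ closure D
    · obtain ⟨s, hs, hc, hxs⟩ := closure_eq_iUnion 𝒯 hx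
      ext i
      have := congrFun (congrFun (congrFun h ⟨s, hs⟩) ⟨x, hxs⟩) i
      simpa [res, hc] using this
    · rw [v.2.2.1 x hx, w.2.2.1 x hx]
  have : FiniteDimensional ℝ (LinearMap.range res) :=
    Submodule.finiteDimensional_of_le hle
  exact LinearEquiv.finiteDimensional (LinearEquiv.ofInjective res hinj).symm

lemma isFiniteMeasure (𝒯 : Triangulation D) :
    IsFiniteMeasure (volume.restrict D : Measure (Eu d)) :=
  ⟨by
    rw [Measure.restrict_apply_univ]
    exact (measure_mono subset_closure).trans_lt (isCompact_closure 𝒯).measure_lt_top⟩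

lemma memLp_of_continuousOn (𝒯 : Triangulation D) {v : Eu d → Eu 3} (p : ENNReal)
    (hv : ContinuousOn v (closure D)) : MemLp v p (volume.restrict D) := by
  have := isFiniteMeasure 𝒯
  obtain ⟨C, hC⟩ := (isCompact_closure 𝒯).exists_bound_of_continuousOn hv
  have hm : AEStronglyMeasurable v (volume.restrict (closure D)) :=
    hv.aestronglyMeasurable isClosed_closure.measurableSet
  refine MemLp.of_bound (hm.mono_measure (Measure.restrict_mono subset_closure le_rfl)) C ?_
  have : ∀ᵐ x ∂(volume.restrict (closure D) : Measure (Eu d)), ‖v x‖ ≤ C :=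
    (ae_restrict_iff' isClosed_closure.measurableSet).2 (ae_of_all _ hC)
  exact ae_mono (Measure.restrict_mono subset_closure le_rfl) this

lemma memLp_Vh (v : Vh 𝒯 r) (p : ENNReal) : MemLp v.1 p (volume.restrict D) :=
  memLp_of_continuousOn 𝒯 p v.2.1

lemma integrable_inner {μ : Measure (Eu d)} {f g : Eu d → Eu 3} (hf : MemLp f 2 μ)
    (hg : MemLp g 2 μ) : Integrable (fun x => inner ℝ (f x) (g x)) μ :=
  (hf.norm.integrable_mul hg.norm).mono' (hf.1.inner hg.1)
    (ae_of_all _ fun x => norm_inner_le_norm (f x) (g x))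

lemma eq_zero_of_l2_self (hD : IsOpen D) (v : Vh 𝒯 r) (h : l2 D v.1 v.1 = 0) : v = 0 := by
  have hi := integrable_inner (memLp_Vh v 2) (memLp_Vh v 2)
  have h0 := (integral_eq_zero_iff_of_nonneg (fun x => real_inner_self_nonneg) hi).1 h
  have h1 : v.1 =ᵐ[volume.restrict D] (0 : Eu d → Eu 3) := by
    filter_upwards [h0] with x hx
    simpa using hx
  have h2 : EqOn v.1 0 D := Measure.eqOn_open_of_ae_eq h1 hD (v.2.1.mono subset_closure)
    continuousOn_const
  apply Subtype.ext
  funext x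
  by_cases hx : x ∈ closure D
  · exact (h2.of_subset_closure v.2.1 continuousOn_const subset_closure le_rfl) hx
  · exact v.2.2.1 x hx

/-- The scalar product of `L²` as a bilinear form on `V_h`. -/
def l2Form (𝒯 : Triangulation D) (r : ℕ) : LinearMap.BilinForm ℝ (Vh 𝒯 r) :=
  LinearMap.mk₂ ℝ (fun v w => l2 D v.1 w.1)
    (fun u v w => by
      simp only [l2, Submodule.coe_add, Pi.add_apply, inner_add_left]
      exact integral_add (integrable_inner (memLp_Vh u 2) (memLp_Vh w 2))
        (integrable_inner (memLp_Vh v 2) (memLp_Vh w 2)))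
    (fun c v w => by
      simp only [l2, Submodule.coe_smul, Pi.smul_apply, inner_smul_left]
      exact integral_const_mul _ _)
    (fun u v w => by
      simp only [l2, Submodule.coe_add, Pi.add_apply, inner_add_right]
      exact integral_add (integrable_inner (memLp_Vh u 2) (memLp_Vh v 2))
        (integrable_inner (memLp_Vh u 2) (memLp_Vh w 2)))
    (fun c v w => by
      simp only [l2, Submodule.coe_smul, Pi.smul_apply, inner_smul_right]
      exact integral_const_mul _ _)

lemma l2_injective (hD : IsOpen D) {p q : Vh 𝒯 r}
    (h : ∀ χ : Vh 𝒯 r, l2 D p.1 χ.1 = l2 D q.1 χ.1) : p = q := by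
  refine sub_eq_zero.1 (eq_zero_of_l2_self hD _ ?_)
  have : l2Form 𝒯 r (p - q) (p - q) = 0 := by
    have h1 : l2Form 𝒯 r p (p - q) = l2Form 𝒯 r q (p - q) := h (p - q)
    rw [LinearMap.map_sub (l2Form 𝒯 r) p q, LinearMap.sub_apply, h1, sub_self]
  exact this

lemma exists_riesz (hD : IsOpen D) (φ : Vh 𝒯 r →ₗ[ℝ] ℝ) :
    ∃ p : Vh 𝒯 r, ∀ χ : Vh 𝒯 r, l2 D p.1 χ.1 = φ χ := by
  have hinj : Function.Injective (l2Form 𝒯 r) := fun p q h =>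
    l2_injective hD fun χ => by
      have := LinearMap.congr_fun h χ
      exact this
  have hsurj : Function.Surjective (l2Form 𝒯 r) :=
    (LinearMap.injective_iff_surjective_of_finrank_eq_finrank
      (Subspace.dual_finrank_eq).symm).1 hinj
  obtain ⟨p, hp⟩ := hsurj φ
  exact ⟨p, fun χ => LinearMap.congr_fun hp χ⟩

lemma l2_sub_left {f g χ : Eu d → Eu 3} (hf : MemLp f 2 (volume.restrict D))
    (hg : MemLp g 2 (volume.restrict D)) (hχ : MemLp χ 2 (volume.restrict D)) :
    l2 D (fun x => f x - g x) χ = l2 D f χ - l2 D g χ := by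
  simp only [l2, inner_sub_left]
  exact integral_sub (integrable_inner hf hχ) (integrable_inner hg hχ)

theorem l2Proj_spec (hD : IsOpen D) {f : Eu d → Eu 3} (hf : MemLp f 2 (volume.restrict D))
    (χ : Vh 𝒯 r) : l2 D (fun x => (l2Proj 𝒯 r f).1 x - f x) χ.1 = 0 := by
  let φ : Vh 𝒯 r →ₗ[ℝ] ℝ :=
    { toFun := fun χ => l2 D f χ.1
      map_add' := fun v w => by
        simp only [l2, Submodule.coe_add, Pi.add_apply, inner_add_right]
        exact integral_add (integrable_inner hf (memLp_Vh v 2))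
          (integrable_inner hf (memLp_Vh w 2))
      map_smul' := fun c v => by
        simp only [l2, Submodule.coe_smul, Pi.smul_apply, inner_smul_right]
        exact integral_const_mul _ _ }
  have hex : ∃ p : Vh 𝒯 r, ∀ χ : Vh 𝒯 r, l2 D (fun x => p.1 x - f x) χ.1 = 0 := by
    obtain ⟨p, hp⟩ := exists_riesz hD φ
    exact ⟨p, fun χ => by
      rw [l2_sub_left (memLp_Vh p 2) hf (memLp_Vh χ 2), hp χ]
      exact sub_self _⟩
  exact Classical.epsilon_spec hex χ

theorem eq_l2Proj (hD : IsOpen D) {f : Eu d → Eu 3} (hf : MemLp f 2 (volume.restrict D))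
    {p : Vh 𝒯 r} (hp : ∀ χ : Vh 𝒯 r, l2 D (fun x => p.1 x - f x) χ.1 = 0) :
    p = l2Proj 𝒯 r f := by
  refine l2_injective hD fun χ => ?_
  have h1 := hp χ
  have h2 := l2Proj_spec (𝒯 := 𝒯) (r := r) hD hf χ
  rw [l2_sub_left (memLp_Vh _ 2) hf (memLp_Vh χ 2)] at h1 h2
  linarith

/-- Off a null set, a point of `D` is interior to an element. -/
lemma ae_interior (𝒯 : Triangulation D) : ∀ᵐ y ∂(volume.restrict D : Measure (Eu d)),
    ∃ K ∈ 𝒯.elements, K ∈ 𝓝 y := by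
  have hnull : volume (⋃ s ∈ {s ∈ 𝒯.complex.faces | s.card = d + 1},
      𝒯.chart '' frontier (convexHull ℝ (s : Set (Eu d)))) = 0 := by
    refine (measure_biUnion_null_iff (𝒯.finite.subset fun s hs => hs.1).countable).2 ?_
    rintro s ⟨hs, hc⟩
    have hcl : IsClosed (convexHull ℝ (s : Set (Eu d))) :=
      (s.finite_toSet.isCompact_convexHull ℝ).isClosed
    refine addHaar_image_eq_zero_of_differentiableOn_of_addHaar_eq_zero volume
      (((𝒯.chart_contDiffOn s hs hc).differentiableOn one_ne_zero).mono hcl.frontier_subset) ?_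
    exact (convex_convexHull ℝ _).addHaar_frontier volume
  have hD : ∀ᵐ y ∂(volume.restrict D : Measure (Eu d)), y ∈ closure D := by
    have := ae_restrict_mem (μ := (volume : Measure (Eu d)))
      (isClosed_closure (s := D)).measurableSet
    exact ae_mono (Measure.restrict_mono subset_closure le_rfl) this
  have hn : ∀ᵐ y ∂(volume.restrict D : Measure (Eu d)),
      y ∉ ⋃ s ∈ {s ∈ 𝒯.complex.faces | s.card = d + 1},
        𝒯.chart '' frontier (convexHull ℝ (s : Set (Eu d))) :=
    ae_mono Measure.restrict_le_self (measure_eq_zero_iff_ae_notMem.1 hnull)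
  filter_upwards [hD, hn] with y hy hyn
  obtain ⟨s, hs, hc, x, hx, rfl⟩ := closure_eq_iUnion 𝒯 hy
  refine ⟨_, ⟨s, hs, hc, rfl⟩, ?_⟩
  have hxi : convexHull ℝ (s : Set (Eu d)) ∈ 𝓝 x := by
    by_contra hcon
    refine hyn (mem_biUnion (show s ∈ {s ∈ 𝒯.complex.faces | s.card = d + 1} from ⟨hs, hc⟩)
      (mem_image_of_mem _ ⟨subset_closure hx, ?_⟩))
    rwa [mem_interior_iff_mem_nhds]
  have hstrict : HasStrictFDerivAt 𝒯.chart (fderiv ℝ 𝒯.chart x) x :=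
    ((𝒯.chart_contDiffOn s hs hc).contDiffAt hxi).hasStrictFDerivAt one_ne_zero
  have hinj := 𝒯.chart_immersion s hs hc x hx
  rw [fderivWithin_of_mem_nhds hxi] at hinj
  have hsurj : (fderiv ℝ 𝒯.chart x).range = ⊤ :=
    LinearMap.range_eq_top.2 (LinearMap.injective_iff_surjective.1 hinj)
  rw [← hstrict.map_nhds_eq_of_surj hsurj]
  exact Filter.image_mem_map hxi

/-- The polynomial map with components `p`. -/
def polyMap (p : Fin 3 → MvPolynomial (Fin d) ℝ) (x : Eu d) : Eu 3 :=
  WithLp.toLp 2 fun i => MvPolynomial.eval (fun j => x j) (p i)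

lemma contDiff_polyMap (p : Fin 3 → MvPolynomial (Fin d) ℝ) : ContDiff ℝ 1 (polyMap p) := by
  have hp : ∀ q : MvPolynomial (Fin d) ℝ,
      ContDiff ℝ 1 fun x : Eu d => MvPolynomial.eval (fun j => x j) q := by
    intro q
    induction q using MvPolynomial.induction_on with
    | C a => simpa using contDiff_const
    | add p q hp hq => simpa using hp.add hq
    | mul_X p i hp =>
      simp only [map_mul, MvPolynomial.eval_X]
      exact hp.mul (by fun_prop)
  rw [contDiff_euclidean]
  exact fun i => hp (p i)

lemma exists_polyMap (v : Vh 𝒯 r) {K : Set (Eu d)} (hK : K ∈ 𝒯.elements) :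
    ∃ p, EqOn v.1 (polyMap p) K := by
  obtain ⟨p, -, hp⟩ := v.2.2.2 K hK
  exact ⟨p, fun x hx => by ext i; exact hp x hx i⟩

lemma ae_differentiableAt (v : Vh 𝒯 r) :
    ∀ᵐ x ∂(volume.restrict D : Measure (Eu d)), DifferentiableAt ℝ v.1 x := by
  filter_upwards [ae_interior 𝒯] with x ⟨K, hK, hx⟩
  obtain ⟨p, hp⟩ := exists_polyMap v hK
  exact ((contDiff_polyMap p).differentiable one_ne_zero x).congr_of_eventuallyEq
    (hp.eventuallyEq_of_mem hx)

lemma elements_finite (𝒯 : Triangulation D) : 𝒯.elements.Finite := by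
  refine (𝒯.finite.image
    fun s : Finset (Eu d) => 𝒯.chart '' convexHull ℝ (s : Set (Eu d))).subset ?_
  rintro K ⟨s, hs, -, rfl⟩
  exact ⟨s, hs, rfl⟩

lemma isCompact_element {K : Set (Eu d)} (hK : K ∈ 𝒯.elements) : IsCompact K := by
  obtain ⟨s, hs, hc, rfl⟩ := hK
  exact (s.finite_toSet.isCompact_convexHull ℝ).image_of_continuousOn
    (𝒯.chart_contDiffOn s hs hc).continuousOn

lemma memLp_pd (v : Vh 𝒯 r) (i : Fin d) (p : ENNReal) :
    MemLp (pd i v.1) p (volume.restrict D) := by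
  have := isFiniteMeasure 𝒯
  have hb : ∀ K ∈ 𝒯.elements, ∃ C : ℝ, ∀ x, K ∈ 𝓝 x → ‖pd i v.1 x‖ ≤ C := by
    intro K hK
    obtain ⟨p, hp⟩ := exists_polyMap v hK
    have hcont : Continuous (pd i (polyMap p)) :=
      ((contDiff_polyMap p).continuous_fderiv one_ne_zero).clm_apply continuous_const
    obtain ⟨C, hC⟩ := (isCompact_element hK).exists_bound_of_continuousOn hcont.continuousOn
    refine ⟨C, fun x hx => ?_⟩
    have : pd i v.1 x = pd i (polyMap p) x := by
      unfold pd
      rw [(hp.eventuallyEq_of_mem hx).fderiv_eq]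
    rw [this]
    exact hC x (mem_of_mem_nhds hx)
  choose! C hC using hb
  obtain ⟨M, hM⟩ := ((elements_finite 𝒯).image C).bddAbove
  refine MemLp.of_bound (measurable_fderiv_apply_const ℝ v.1 _).aestronglyMeasurable M ?_
  filter_upwards [ae_interior 𝒯] with x ⟨K, hK, hx⟩
  exact (hC K hK x hx).trans (hM (mem_image_of_mem _ hK))

lemma integrable_grad (v w : Vh 𝒯 r) :
    Integrable (fun x => ∑ i, inner ℝ (pd i v.1 x) (pd i w.1 x)) (volume.restrict D) :=
  integrable_finsetSum _ fun i _ => integrable_inner (memLp_pd v i 2) (memLp_pd w i 2)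

theorem discLap_spec (hD : IsOpen D) (v χ : Vh 𝒯 r) :
    l2 D (discLap 𝒯 r v).1 χ.1 = -l2Grad D v.1 χ.1 := by
  let φ : Vh 𝒯 r →ₗ[ℝ] ℝ :=
    { toFun := fun χ => -l2Grad D v.1 χ.1
      map_add' := fun f g => by
        rw [← neg_add]
        congr 1
        unfold l2Grad
        rw [← integral_add (integrable_grad v f) (integrable_grad v g)]
        refine integral_congr_ae ?_
        filter_upwards [ae_differentiableAt f, ae_differentiableAt g] with x hf hg
        simp only [pd, Submodule.coe_add, fderiv_add hf hg, add_apply,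
          inner_add_right, Finset.sum_add_distrib]
      map_smul' := fun c f => by
        simp only [RingHom.id_apply, smul_eq_mul, mul_neg]
        congr 1
        unfold l2Grad
        rw [← integral_const_mul]
        refine integral_congr_ae ?_
        filter_upwards [ae_differentiableAt f] with x hf
        simp only [pd, Submodule.coe_smul, fderiv_const_smul hf, smul_apply,
          inner_smul_right, Finset.mul_sum] }
  have hex : ∃ p : Vh 𝒯 r, ∀ χ : Vh 𝒯 r, l2 D p.1 χ.1 = -l2Grad D v.1 χ.1 :=
    exists_riesz hD φ
  exact Classical.epsilon_spec hex χ

theorem eq_discLap (hD : IsOpen D) {v p : Vh 𝒯 r}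
    (hp : ∀ χ : Vh 𝒯 r, l2 D p.1 χ.1 = -l2Grad D v.1 χ.1) : p = discLap 𝒯 r v :=
  l2_injective hD fun χ => (hp χ).trans (discLap_spec hD v χ).symm

end WellDefined

end LLB

end

open MeasureTheory Set Topology

noncomputable section

namespace LLB

section ZeroOfCoerciveField

/-- The interpolation formula at `1` with `n` equispaced nodes in `[0, ε)`. -/
lemma exists_extrapolation (n : ℕ) {ε : ℝ} (hε : 0 < ε) :
    ∃ (w τ : Fin (n + 1) → ℝ), (∀ i, 0 ≤ τ i ∧ τ i < ε) ∧
      ∀ p : Polynomial ℝ, p.natDegree ≤ n → p.eval 1 = ∑ i, w i * p.eval (τ i) := by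
  let τ : Fin (n + 1) → ℝ := fun i => ε * (i / (n + 1))
  have hτ : InjOn τ (Finset.univ : Finset (Fin (n + 1))) := by
    intro i _ j _ h
    have h1 : ((i : ℕ) : ℝ) = (j : ℕ) := by
      have := mul_left_cancel₀ hε.ne' h
      field_simp at this
      exact this
    exact Fin.ext (by exact_mod_cast h1)
  refine ⟨fun i => (Lagrange.basis Finset.univ τ i).eval 1, τ, fun i => ⟨by positivity, ?_⟩, ?_⟩
  · have : ((i : ℕ) : ℝ) / (n + 1) < 1 := by
      rw [div_lt_one (by positivity)]
      exact_mod_cast i.2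
    calc ε * ((i : ℕ) / (n + 1)) < ε * 1 := by gcongr
      _ = ε := mul_one _
  · intro p hp
    have hdeg : p.degree < (Finset.univ : Finset (Fin (n + 1))).card := by
      refine lt_of_le_of_lt Polynomial.degree_le_natDegree ?_
      simp only [Finset.card_univ, Fintype.card_fin]
      exact_mod_cast Nat.lt_succ_of_le hp
    conv_lhs => rw [Lagrange.eq_interpolate hτ hdeg, Lagrange.interpolate_apply,
      Polynomial.eval_finsetSum]
    simp [mul_comm]

variable {E : Type*} [NormedAddCommGroup E] [InnerProductSpace ℝ E] [FiniteDimensional ℝ E]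

lemma exists_polynomial_det_mul_pow (A : E →L[ℝ] E) (x v : E) (a : ℝ) (m : ℕ) :
    ∃ p : Polynomial ℝ, p.natDegree ≤ Module.finrank ℝ E + 2 * m ∧
      ∀ t, p.eval t = (ContinuousLinearMap.id ℝ E + t • A).det * (a - ‖x + t • v‖ ^ 2) ^ m := by
  classical
  let b := Module.finBasis ℝ E
  let Q : Matrix (Fin (Module.finrank ℝ E)) (Fin (Module.finrank ℝ E)) ℝ := LinearMap.toMatrix b b (A : E →ₗ[ℝ] E)
  let p₁ : Polynomial ℝ := ((Polynomial.X : Polynomial ℝ) • Q.map Polynomial.C +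
    (1 : Matrix (Fin (Module.finrank ℝ E)) (Fin (Module.finrank ℝ E)) ℝ).map Polynomial.C).det
  let p₂ : Polynomial ℝ := Polynomial.C (-‖v‖ ^ 2) * Polynomial.X ^ 2 +
    Polynomial.C (-(2 * inner ℝ x v)) * Polynomial.X + Polynomial.C (a - ‖x‖ ^ 2)
  refine ⟨p₁ * p₂ ^ m, ?_, fun t => ?_⟩
  · refine Polynomial.natDegree_mul_le.trans (add_le_add ?_ ?_)
    · exact (Polynomial.natDegree_det_X_add_C_le Q 1).trans_eq (Fintype.card_fin _)
    · refine Polynomial.natDegree_pow_le.trans ?_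
      rw [mul_comm]
      exact Nat.mul_le_mul_right _ Polynomial.natDegree_quadratic_le
  · rw [Polynomial.eval_mul, Polynomial.eval_pow]
    congr 1
    · rw [ContinuousLinearMap.det, ← LinearMap.det_toMatrix b, ← Polynomial.coe_evalRingHom,
        RingHom.map_det]
      congr 1
      ext i j
      by_cases hij : i = j
      · simp [Q, LinearMap.toMatrix_apply, hij]
        ring
      · simp [Q, LinearMap.toMatrix_apply, hij]
        ring
    · congr 1
      rw [norm_add_sq_real, norm_smul, inner_smul_right, mul_pow, Real.norm_eq_abs, sq_abs]
      simp [p₂]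
      ring

lemma det_id_add_pos {A : E →L[ℝ] E} (hA : ‖A‖ < 1) :
    0 < (ContinuousLinearMap.id ℝ E + A).det := by
  have hne : ∀ t ∈ Icc (0 : ℝ) 1, (ContinuousLinearMap.id ℝ E + t • A).det ≠ 0 := by
    intro t ht hdet
    obtain ⟨v, hv, hv0⟩ : ∃ v, (ContinuousLinearMap.id ℝ E + t • A) v = 0 ∧ v ≠ 0 := by
      obtain ⟨v, hv, hv0⟩ := (Submodule.ne_bot_iff _).1
        (LinearMap.bot_lt_ker_of_det_eq_zero hdet).ne'
      exact ⟨v, hv, hv0⟩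
    have h1 : ‖v‖ = ‖t • A v‖ := by
      rw [← norm_neg v]
      congr 1
      exact neg_eq_of_add_eq_zero_right hv
    have h2 : ‖t • A v‖ ≤ ‖A‖ * ‖v‖ := by
      rw [norm_smul, Real.norm_of_nonneg ht.1]
      calc t * ‖A v‖ ≤ 1 * ‖A v‖ := by gcongr; exact ht.2
        _ ≤ _ := by rw [one_mul]; exact A.le_opNorm v
    have h3 : 0 < ‖v‖ := norm_pos_iff.2 hv0
    nlinarith
  have hcont : ContinuousOn (fun t : ℝ => (ContinuousLinearMap.id ℝ E + t • A).det) (Icc 0 1) :=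
    (ContinuousLinearMap.continuous_det.comp (by fun_prop)).continuousOn
  by_contra! hcon
  have h0 : (ContinuousLinearMap.id ℝ E + (0 : ℝ) • A).det = 1 := by
    simp [ContinuousLinearMap.det]
  obtain ⟨t, ht, hzero⟩ := intermediate_value_Icc' zero_le_one hcont
    (show (0 : ℝ) ∈ Icc _ _ from ⟨by simpa using hcon, by rw [h0]; exact zero_le_one⟩)
  exact hne t ht hzero

lemma bijective_id_add {h : E → E} {c : NNReal} (hc : c < 1) (hh : LipschitzWith c h) :
    Function.Bijective fun x => x + h x := by
  constructor
  · intro x y hxy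
    have h1 : x - y = h y - h x := by
      rw [sub_eq_sub_iff_add_eq_add]
      simpa [add_comm] using hxy
    have h2 := hh.norm_sub_le y x
    rw [← h1, norm_sub_rev y x] at h2
    have hc' : (c : ℝ) < 1 := by exact_mod_cast hc
    have : ‖x - y‖ = 0 := by
      by_contra h0
      have : 0 < ‖x - y‖ := lt_of_le_of_ne (norm_nonneg _) (Ne.symm h0)
      nlinarith
    exact sub_eq_zero.1 (norm_eq_zero.1 this)
  · intro y
    have hcon : ContractingWith c fun x => y - h x :=
      ⟨hc, LipschitzWith.of_dist_le_mul fun u v => by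
        rw [dist_sub_left]
        exact hh.dist_le_mul u v⟩
    have := hcon.fixedPoint_isFixedPt
    refine ⟨hcon.fixedPoint, ?_⟩
    have h2 : y - h hcon.fixedPoint = hcon.fixedPoint := this
    exact sub_eq_iff_eq_add.1 h2 |>.symm

variable [MeasurableSpace E] [BorelSpace E]

lemma setIntegral_det_mul_comp {h : E → E} (hh : ContDiff ℝ 1 h) {c : NNReal} (hc : c < 1)
    (hL : LipschitzWith c h) {B : Set E} (hB : MeasurableSet B) (hzero : ∀ x ∉ B, h x = 0)
    (φ : E → ℝ) :
    ∫ x in B, (ContinuousLinearMap.id ℝ E + fderiv ℝ h x).det * φ (x + h x) = ∫ x in B, φ x := by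
  have hbij := bijective_id_add hc hL
  have himg : (fun x => x + h x) '' B = B := by
    have hcompl : (fun x => x + h x) '' Bᶜ = Bᶜ := by
      have : EqOn (fun x => x + h x) id Bᶜ := fun x hx => by simp [hzero x hx]
      rw [this.image_eq, image_id]
    rw [← compl_inj_iff, ← image_compl_eq hbij, hcompl]
  have key := integral_image_eq_integral_abs_det_fderiv_smul volume hB
    (f := fun x => x + h x) (f' := fun x => ContinuousLinearMap.id ℝ E + fderiv ℝ h x)
    (fun x _ => ((hasFDerivAt_id x).add
      (hh.differentiable one_ne_zero x).hasFDerivAt).hasFDerivWithinAt) hbij.1.injOn φ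
  rw [himg] at key
  rw [key]
  refine integral_congr_ae (ae_of_all _ fun x => ?_)
  have hpos : 0 < (ContinuousLinearMap.id ℝ E + fderiv ℝ h x).det :=
    det_id_add_pos ((norm_fderiv_le_of_lipschitz ℝ hL).trans_lt (by exact_mod_cast hc))
  simp [abs_of_pos hpos]

/-- The change of variables formula for `x ↦ x + g x`, with `g` of compact support, and the
polynomials `(a - ‖y‖²) ^ m`. Injectivity is not needed: for small `t` it holds for `x + t • g x`,
and both sides are polynomials in `t`. -/
lemma setIntegral_det_mul_pow {g : E → E} (hg : ContDiff ℝ 1 g) (hgc : HasCompactSupport g)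
    {B : Set E} (hB : IsCompact B) (hzero : ∀ x ∉ B, g x = 0) (a : ℝ) (m : ℕ) :
    ∫ x in B, (ContinuousLinearMap.id ℝ E + fderiv ℝ g x).det * (a - ‖x + g x‖ ^ 2) ^ m =
      ∫ x in B, (a - ‖x‖ ^ 2) ^ m := by
  obtain ⟨K, hK⟩ := hg.lipschitzWith_of_hasCompactSupport hgc one_ne_zero
  let I : ℝ → E → ℝ := fun t x =>
    (ContinuousLinearMap.id ℝ E + t • fderiv ℝ g x).det * (a - ‖x + t • g x‖ ^ 2) ^ m
  have hIcont : ∀ t, Continuous (I t) := by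
    intro t
    have h1 := hg.continuous_fderiv one_ne_zero
    have h2 := hg.continuous
    exact (ContinuousLinearMap.continuous_det.comp (by fun_prop)).mul (by fun_prop)
  have hIint : ∀ t, IntegrableOn (I t) B := fun t => (hIcont t).continuousOn.integrableOn_compact hB
  have hsmall : ∀ t, 0 ≤ t → t < ((K : ℝ) + 1)⁻¹ → ∫ x in B, I t x = ∫ x in B, (a - ‖x‖ ^ 2) ^ m := by
    intro t ht0 ht
    have hK' : LipschitzWith (Real.toNNReal t * K) fun x => t • g x := by
      refine LipschitzWith.of_dist_le_mul fun x y => ?_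
      rw [dist_smul₀, Real.norm_of_nonneg ht0, NNReal.coe_mul, Real.coe_toNNReal t ht0, mul_assoc]
      exact mul_le_mul_of_nonneg_left (hK.dist_le_mul x y) ht0
    have hc : Real.toNNReal t * K < 1 := by
      rw [← NNReal.coe_lt_coe, NNReal.coe_mul, Real.coe_toNNReal t ht0, NNReal.coe_one]
      have hK0 : (0 : ℝ) ≤ K := K.2
      have h2 : t * (K + 1) < 1 := by rwa [← lt_div_iff₀ (by positivity), one_div]
      nlinarith
    have := setIntegral_det_mul_comp (hg.const_smul t) hc hK' hB.isClosed.measurableSet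
      (fun x hx => by simp [hzero x hx]) fun y => (a - ‖y‖ ^ 2) ^ m
    rw [← this]
    refine integral_congr_ae (ae_of_all _ fun x => ?_)
    simp only [I]
    rw [fderiv_fun_const_smul (hg.differentiable one_ne_zero x)]
  obtain ⟨w, τ, hτ, hw⟩ := exists_extrapolation (Module.finrank ℝ E + 2 * m)
    (ε := ((K : ℝ) + 1)⁻¹) (by positivity)
  have hI1 : ∀ x, I 1 x = ∑ i, w i * I (τ i) x := by
    intro x
    obtain ⟨p, hp, hpe⟩ := exists_polynomial_det_mul_pow (fderiv ℝ g x) x (g x) a m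
    simpa only [hpe] using hw p hp
  have hw1 : ∑ i, w i = 1 := by simpa using (hw 1 (by simp)).symm
  calc _ = ∫ x in B, I 1 x := by simp [I]
    _ = ∑ i, w i * ∫ x in B, I (τ i) x := by
      simp_rw [hI1]
      rw [integral_finsetSum _ fun i _ => (hIint (τ i)).const_mul (w i)]
      simp_rw [integral_const_mul]
    _ = _ := by
      simp_rw [fun i => hsmall (τ i) (hτ i).1 (hτ i).2, ← Finset.sum_mul, hw1, one_mul]

/-- A `C¹` map that is the identity off a compact set has a zero. -/
lemma exists_id_add_eq_zero {g : E → E} (hg : ContDiff ℝ 1 g) (hgc : HasCompactSupport g) :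
    ∃ x, x + g x = 0 := by
  by_contra! hne
  obtain ⟨R, hR⟩ := hgc.isCompact.isBounded.subset_closedBall (0 : E)
  let R' := max R 1
  let B := Metric.closedBall (0 : E) R'
  have hB : IsCompact B := isCompact_closedBall 0 R'
  have hzero : ∀ x ∉ B, g x = 0 := fun x hx => image_eq_zero_of_notMem_tsupport fun h =>
    hx (Metric.closedBall_subset_closedBall (le_max_left _ _) (hR h))
  have h0B : (0 : E) ∈ B := Metric.mem_closedBall_self (by positivity)
  have hfc : Continuous fun x => ‖x + g x‖ := (continuous_id.add hg.continuous).norm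
  obtain ⟨x₀, hx₀, hmin⟩ := hB.exists_isMinOn ⟨0, h0B⟩ hfc.continuousOn
  obtain ⟨x₁, hx₁, hmax⟩ := hB.exists_isMaxOn ⟨0, h0B⟩ hfc.continuousOn
  let δ := ‖x₀ + g x₀‖
  have hδ : 0 < δ := norm_pos_iff.2 (hne x₀)
  let M := max ‖x₁ + g x₁‖ R'
  have hδM : δ ≤ M := (hmin hx₁).trans (le_max_left _ _)
  have hR'1 : 1 ≤ R' := le_max_right _ _
  have hR'M : R' ≤ M := le_max_right _ _
  let ρ := min (δ / 2) 1
  have hρ : 0 < ρ := by positivity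
  have hρδ : ρ < δ := (min_le_left _ _).trans_lt (half_lt_self hδ)
  have hρ1 : ρ ≤ 1 := min_le_right _ _
  let s := M ^ 2 - δ ^ 2
  let S := M ^ 2 - ρ ^ 2
  have hs : 0 ≤ s := sub_nonneg.2 (by gcongr)
  have hsS : s < S := sub_lt_sub_left (by gcongr) _
  have hS : 0 < S := hs.trans_lt hsS
  have hdetc : Continuous fun x => (ContinuousLinearMap.id ℝ E + fderiv ℝ g x).det :=
    ContinuousLinearMap.continuous_det.comp
      (continuous_const.add (hg.continuous_fderiv one_ne_zero))
  obtain ⟨C, hC⟩ := hB.exists_bound_of_continuousOn hdetc.continuousOn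
  have hC0 : 0 ≤ C := (norm_nonneg _).trans (hC 0 h0B)
  have hupper : ∀ m : ℕ, ∫ x in B, (ContinuousLinearMap.id ℝ E + fderiv ℝ g x).det *
      (M ^ 2 - ‖x + g x‖ ^ 2) ^ m ≤ C * s ^ m * volume.real B := by
    intro m
    refine (Real.le_norm_self _).trans
      (norm_setIntegral_le_of_norm_le_const hB.measure_lt_top fun x hx => ?_)
    have h1 : δ ≤ ‖x + g x‖ := hmin hx
    have h2 : ‖x + g x‖ ≤ M := (hmax hx).trans (le_max_left _ _)
    have h3 : 0 ≤ M ^ 2 - ‖x + g x‖ ^ 2 := sub_nonneg.2 (by gcongr)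
    rw [norm_mul, norm_pow, Real.norm_of_nonneg h3]
    exact mul_le_mul (hC x hx)
      (pow_le_pow_left₀ h3 (sub_le_sub_left (by gcongr) _) m) (by positivity) hC0
  have hlower : ∀ m : ℕ, S ^ m * volume.real (Metric.closedBall (0 : E) ρ) ≤
      ∫ x in B, (M ^ 2 - ‖x‖ ^ 2) ^ m := by
    intro m
    have hcont : Continuous fun x : E => (M ^ 2 - ‖x‖ ^ 2) ^ m := by fun_prop
    have hsub : Metric.closedBall (0 : E) ρ ⊆ B :=
      Metric.closedBall_subset_closedBall (hρ1.trans hR'1)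
    calc S ^ m * volume.real (Metric.closedBall (0 : E) ρ)
        = ∫ x in Metric.closedBall (0 : E) ρ, S ^ m := by
          rw [setIntegral_const, smul_eq_mul, mul_comm]
      _ ≤ ∫ x in Metric.closedBall (0 : E) ρ, (M ^ 2 - ‖x‖ ^ 2) ^ m := by
          refine setIntegral_mono_on (integrableOn_const (measure_closedBall_lt_top.ne))
            (hcont.continuousOn.integrableOn_compact (isCompact_closedBall _ _))
            Metric.isClosed_closedBall.measurableSet fun x hx => ?_
          have : ‖x‖ ≤ ρ := mem_closedBall_zero_iff.1 hx
          exact pow_le_pow_left₀ hS.le (sub_le_sub_left (by gcongr) _) m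
      _ ≤ _ := by
          refine setIntegral_mono_set (hcont.continuousOn.integrableOn_compact hB) ?_
            hsub.eventuallyLE
          refine (ae_restrict_iff' hB.isClosed.measurableSet).2 (ae_of_all _ fun x hx => ?_)
          have h1 : ‖x‖ ≤ M := (mem_closedBall_zero_iff.1 hx).trans hR'M
          exact pow_nonneg (sub_nonneg.2 (by gcongr)) m
  have hvol : 0 < volume.real (Metric.closedBall (0 : E) ρ) :=
    ENNReal.toReal_pos (Metric.measure_closedBall_pos volume 0 hρ).ne' measure_closedBall_lt_top.ne
  have hlim : Filter.Tendsto (fun m : ℕ => C * volume.real B * (s / S) ^ m) Filter.atTop (𝓝 0) := by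
    simpa using (tendsto_pow_atTop_nhds_zero_of_lt_one (div_nonneg hs hS.le)
      ((div_lt_one hS).2 hsS)).const_mul (C * volume.real B)
  obtain ⟨m, hm⟩ := (hlim.eventually (gt_mem_nhds hvol)).exists
  have h1 := (hlower m).trans
    ((setIntegral_det_mul_pow hg hgc hB hzero (M ^ 2) m).symm.le.trans (hupper m))
  rw [div_pow, mul_div_assoc', div_lt_iff₀ (pow_pos hS m)] at hm
  nlinarith

/-- A `C¹` vector field that points outwards off a ball has a zero. -/
theorem exists_zero_of_inner_pos {F : E → E} (hF : ContDiff ℝ 1 F) {R : ℝ}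
    (hpos : ∀ x, R ≤ ‖x‖ → 0 < inner ℝ (F x) x) : ∃ x, F x = 0 := by
  let b : ContDiffBump (0 : E) := ⟨max R 1, max R 1 + 1, by positivity, by linarith⟩
  obtain ⟨x, hx⟩ := exists_id_add_eq_zero (g := fun x => b x • (F x - x))
    (b.contDiff.smul (hF.sub contDiff_id)) b.hasCompactSupport.smul_right
  refine ⟨x, ?_⟩
  rcases le_total ‖x‖ (max R 1) with h | h
  · have : b x = 1 := b.one_of_mem_closedBall (mem_closedBall_zero_iff.2 h)
    simpa [this] using hx
  · exfalso
    have h1 := hpos x ((le_max_left _ _).trans h)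
    have h2 : 0 < ‖x‖ := (lt_max_of_lt_right one_pos).trans_le h
    have h3 : b x * inner ℝ (F x) x + (1 - b x) * ‖x‖ ^ 2 = 0 := by
      have := congrArg (fun y => inner ℝ y x) hx
      simp only [inner_add_left, inner_smul_left, inner_sub_left, inner_zero_left,
        real_inner_self_eq_norm_sq] at this
      simp only [conj_trivial] at this
      linarith
    have hb0 : 0 ≤ b x := b.nonneg
    have hb1 : b x ≤ 1 := b.le_one
    rcases hb0.eq_or_lt with h0 | h0
    · rw [← h0] at h3
      nlinarith
    · have := mul_pos h0 h1
      have := mul_nonneg (sub_nonneg.2 hb1) (sq_nonneg ‖x‖)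
      linarith

end ZeroOfCoerciveField

section WeaklyContDiff

variable {E : Type*} [NormedAddCommGroup E] [NormedSpace ℝ E]
variable {V W U : Type*} [AddCommGroup V] [Module ℝ V] [AddCommGroup W] [Module ℝ W]
  [AddCommGroup U] [Module ℝ U]

/-- A map into a vector space without topology is weakly `C¹` if its composition with every linear
functional is `C¹`. -/
def WeaklyContDiff (G : E → V) : Prop := ∀ φ : Module.Dual ℝ V, ContDiff ℝ 1 fun c => φ (G c)

lemma WeaklyContDiff.contDiff {G : E → ℝ} (hG : WeaklyContDiff G) : ContDiff ℝ 1 G :=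
  hG LinearMap.id

lemma WeaklyContDiff.add {G H : E → V} (hG : WeaklyContDiff G) (hH : WeaklyContDiff H) :
    WeaklyContDiff fun c => G c + H c := fun φ => by
  simpa using (hG φ).add (hH φ)

lemma WeaklyContDiff.sub {G H : E → V} (hG : WeaklyContDiff G) (hH : WeaklyContDiff H) :
    WeaklyContDiff fun c => G c - H c := fun φ => by
  simpa using (hG φ).sub (hH φ)

lemma WeaklyContDiff.const (v : V) : WeaklyContDiff fun _ : E => v := fun _ => contDiff_const

lemma WeaklyContDiff.map (L : V →ₗ[ℝ] W) {G : E → V} (hG : WeaklyContDiff G) :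
    WeaklyContDiff fun c => L (G c) := fun φ => hG (φ ∘ₗ L)

lemma weaklyContDiff_linearMap [FiniteDimensional ℝ E] (Φ : E →ₗ[ℝ] V) :
    WeaklyContDiff fun c => Φ c := fun φ =>
  (LinearMap.toContinuousLinearMap (φ ∘ₗ Φ)).contDiff

lemma WeaklyContDiff.map₂ [FiniteDimensional ℝ V] (L : V →ₗ[ℝ] W →ₗ[ℝ] U) {G : E → V} {H : E → W}
    (hG : WeaklyContDiff G) (hH : WeaklyContDiff H) : WeaklyContDiff fun c => L (G c) (H c) := by
  intro φ
  let b := Module.finBasis ℝ V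
  have h : ∀ c, φ (L (G c) (H c)) = ∑ i, b.coord i (G c) * φ (L (b i) (H c)) := by
    intro c
    calc φ (L (G c) (H c)) = φ (L (∑ i, b.repr (G c) i • b i) (H c)) := by rw [b.sum_repr]
      _ = _ := by simp only [map_sum, map_smul, LinearMap.sum_apply, LinearMap.smul_apply,
          smul_eq_mul, Module.Basis.coord_apply]
  simp_rw [h]
  exact ContDiff.sum fun i _ => (hG (b.coord i)).mul (hH (φ ∘ₗ L (b i)))

end WeaklyContDiff

/-- A nonlinear weak equation `T u = 0` in a finite-dimensional space is solvable if `T` is `C¹`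
and coercive. -/
theorem exists_zero_of_coercive {V : Type*} [AddCommGroup V] [Module ℝ V] [FiniteDimensional ℝ V]
    (T : V → Module.Dual ℝ V)
    (hT : ∀ (n : ℕ) (Φ : EuclideanSpace ℝ (Fin n) →ₗ[ℝ] V), WeaklyContDiff fun c => T (Φ c))
    (q : LinearMap.BilinForm ℝ V) (hq : ∀ v, v ≠ 0 → 0 < q v v) (l : Module.Dual ℝ V)
    (hcoer : ∀ v, q v v - l v ≤ T v v) : ∃ u, T u = 0 := by
  let b := Module.finBasis ℝ V
  let Φ : EuclideanSpace ℝ (Fin (Module.finrank ℝ V)) ≃ₗ[ℝ] V :=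
    (WithLp.linearEquiv 2 ℝ _).trans b.equivFun.symm
  have hΦ : ∀ c, Φ c = ∑ i, c i • b i := fun c => b.equivFun_symm_apply _
  have hΦC : WeaklyContDiff fun c => Φ c := weaklyContDiff_linearMap Φ.toLinearMap
  let F : EuclideanSpace ℝ (Fin (Module.finrank ℝ V)) →
      EuclideanSpace ℝ (Fin (Module.finrank ℝ V)) := fun c => WithLp.toLp 2 fun j => T (Φ c) (b j)
  have hF : ContDiff ℝ 1 F := by
    rw [contDiff_euclidean]
    exact fun j => hT _ Φ.toLinearMap (Module.Dual.eval ℝ V (b j))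
  have hFinner : ∀ c, inner ℝ (F c) c = T (Φ c) (Φ c) := by
    intro c
    have h : ∀ τ : Module.Dual ℝ V, τ (Φ c) = ∑ i, c i * τ (b i) := fun τ => by
      rw [hΦ c]
      simp
    rw [h]
    simp [PiLp.inner_apply, F]
  have hqc : Continuous fun c => q (Φ c) (Φ c) := (hΦC.map₂ q hΦC).contDiff.continuous
  obtain ⟨m, hm, hmq⟩ : ∃ m, 0 < m ∧ ∀ c, m * ‖c‖ ^ 2 ≤ q (Φ c) (Φ c) := by
    rcases (Metric.sphere (0 : EuclideanSpace ℝ (Fin (Module.finrank ℝ V))) 1).eq_empty_or_nonempty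
      with he | hne
    · refine ⟨1, one_pos, fun c => ?_⟩
      have hc : c = 0 := by
        by_contra h
        have : ‖c‖⁻¹ • c ∈ Metric.sphere (0 : EuclideanSpace ℝ (Fin (Module.finrank ℝ V))) 1 := by
          simp [norm_smul, inv_mul_cancel₀ (norm_ne_zero_iff.2 h)]
        rw [he] at this
        exact this
      simp [hc]
    · obtain ⟨c₀, hc₀, hmin⟩ := (isCompact_sphere _ _).exists_isMinOn hne hqc.continuousOn
      have hc₀0 : c₀ ≠ 0 := by
        rintro rfl
        simp at hc₀
      refine ⟨q (Φ c₀) (Φ c₀), hq _ (by simpa using hc₀0), fun c => ?_⟩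
      rcases eq_or_ne c 0 with rfl | h
      · simp
      · have h1 : ‖c‖⁻¹ • c ∈ Metric.sphere (0 : EuclideanSpace ℝ (Fin (Module.finrank ℝ V))) 1 := by
          simp [norm_smul, inv_mul_cancel₀ (norm_ne_zero_iff.2 h)]
        have h2 : q (Φ c₀) (Φ c₀) ≤ q (Φ (‖c‖⁻¹ • c)) (Φ (‖c‖⁻¹ • c)) := hmin h1
        have h3 : 0 < ‖c‖ := norm_pos_iff.2 h
        simp only [map_smul, LinearMap.smul_apply, smul_eq_mul] at h2
        rw [← mul_assoc, ← mul_inv, inv_mul_eq_div, le_div_iff₀ (by positivity)] at h2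
        rwa [sq]
  let L := LinearMap.toContinuousLinearMap (l ∘ₗ Φ.toLinearMap)
  have hL : ∀ c, l (Φ c) ≤ ‖L‖ * ‖c‖ := fun c => (Real.le_norm_self _).trans (L.le_opNorm c)
  obtain ⟨c, hc⟩ := exists_zero_of_inner_pos hF (R := ‖L‖ / m + 1) fun c hc => by
    rw [hFinner]
    refine lt_of_lt_of_le ?_ (hcoer _)
    have h1 := hmq c
    have h2 := hL c
    have h3 : 0 < ‖c‖ := lt_of_lt_of_le (by positivity) hc
    have h4 : ‖L‖ < m * ‖c‖ := by
      rw [← div_lt_iff₀' hm]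
      linarith
    nlinarith
  refine ⟨Φ c, b.ext fun j => ?_⟩
  exact congrArg (fun y => y.ofLp j) hc

section DiscreteOperators

variable {d : ℕ} {D : Set (Eu d)} {𝒯 : Triangulation D} {r : ℕ}

lemma l2_add_left {f g χ : Eu d → Eu 3} (hf : MemLp f 2 (volume.restrict D))
    (hg : MemLp g 2 (volume.restrict D)) (hχ : MemLp χ 2 (volume.restrict D)) :
    l2 D (fun x => f x + g x) χ = l2 D f χ + l2 D g χ := by
  simp only [l2, inner_add_left]
  exact integral_add (integrable_inner hf hχ) (integrable_inner hg hχ)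

lemma l2_smul_left (c : ℝ) (f χ : Eu d → Eu 3) : l2 D (fun x => c • f x) χ = c * l2 D f χ := by
  simp only [l2, inner_smul_left]
  exact integral_const_mul _ _

/-- The functional `χ ↦ ⟨f, χ⟩` on `V_h`. -/
def l2Functional (𝒯 : Triangulation D) (r : ℕ) (f : Eu d → Eu 3)
    (hf : MemLp f 2 (volume.restrict D)) : Module.Dual ℝ (Vh 𝒯 r) where
  toFun χ := l2 D f χ.1
  map_add' v w := by
    simp only [l2, Submodule.coe_add, Pi.add_apply, inner_add_right]
    exact integral_add (integrable_inner hf (memLp_Vh v 2)) (integrable_inner hf (memLp_Vh w 2))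
  map_smul' c v := by
    simp only [l2, Submodule.coe_smul, Pi.smul_apply, inner_smul_right]
    exact integral_const_mul _ _

lemma l2Grad_comm (f g : Eu d → Eu 3) : l2Grad D f g = l2Grad D g f := by
  simp only [l2Grad, real_inner_comm]

lemma l2_l2Proj (hD : IsOpen D) {f : Eu d → Eu 3} (hf : MemLp f 2 (volume.restrict D))
    (χ : Vh 𝒯 r) : l2 D (l2Proj 𝒯 r f).1 χ.1 = l2 D f χ.1 := by
  have h := l2Proj_spec (𝒯 := 𝒯) (r := r) hD hf χ
  rw [l2_sub_left (memLp_Vh _ 2) hf (memLp_Vh χ 2)] at h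
  exact sub_eq_zero.1 h

lemma l2Proj_add (hD : IsOpen D) {f g : Eu d → Eu 3} (hf : MemLp f 2 (volume.restrict D))
    (hg : MemLp g 2 (volume.restrict D)) :
    l2Proj 𝒯 r (fun x => f x + g x) = l2Proj 𝒯 r f + l2Proj 𝒯 r g := by
  refine l2_injective hD fun χ => ?_
  have hfg : MemLp (fun x => f x + g x) 2 (volume.restrict D) := hf.add hg
  rw [l2_l2Proj hD hfg, l2_add_left hf hg (memLp_Vh χ 2), ← l2_l2Proj hD hf,
    ← l2_l2Proj hD hg]
  exact (l2_add_left (memLp_Vh _ 2) (memLp_Vh _ 2) (memLp_Vh χ 2)).symm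

lemma l2Proj_smul (hD : IsOpen D) (c : ℝ) {f : Eu d → Eu 3}
    (hf : MemLp f 2 (volume.restrict D)) :
    l2Proj 𝒯 r (fun x => c • f x) = c • l2Proj 𝒯 r f := by
  refine l2_injective hD fun χ => ?_
  have hcf : MemLp (fun x => c • f x) 2 (volume.restrict D) := hf.const_smul c
  rw [l2_l2Proj hD hcf, l2_smul_left, ← l2_l2Proj hD hf]
  exact (l2_smul_left _ _ _).symm

lemma memLp_inner_smul (u v w : Vh 𝒯 r) :
    MemLp (fun x => inner ℝ (u.1 x) (v.1 x) • w.1 x) 2 (volume.restrict D) :=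
  memLp_of_continuousOn 𝒯 2 ((u.2.1.inner (𝕜 := ℝ) v.2.1).fun_smul w.2.1)

/-- The trilinear map `(u, v, w) ↦ P_h((u · v) w)`. -/
def projTrilinear (𝒯 : Triangulation D) (r : ℕ) (hD : IsOpen D) :
    Vh 𝒯 r →ₗ[ℝ] Vh 𝒯 r →ₗ[ℝ] Vh 𝒯 r →ₗ[ℝ] Vh 𝒯 r :=
  LinearMap.mk₂ ℝ
    (fun u v =>
      { toFun := fun w => l2Proj 𝒯 r fun x => inner ℝ (u.1 x) (v.1 x) • w.1 x
        map_add' := fun w w' => by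
          rw [← l2Proj_add hD (memLp_inner_smul u v w) (memLp_inner_smul u v w')]
          simp only [Submodule.coe_add, Pi.add_apply, smul_add]
        map_smul' := fun c w => by
          rw [RingHom.id_apply, ← l2Proj_smul hD c (memLp_inner_smul u v w)]
          simp only [Submodule.coe_smul, Pi.smul_apply, smul_comm c] })
    (fun u u' v => LinearMap.ext fun w => by
      refine Eq.trans ?_ (l2Proj_add hD (memLp_inner_smul u v w) (memLp_inner_smul u' v w))
      simp only [LinearMap.coe_mk, AddHom.coe_mk, Submodule.coe_add, Pi.add_apply, inner_add_left,
        add_smul])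
    (fun c u v => LinearMap.ext fun w => by
      refine Eq.trans ?_ (l2Proj_smul hD c (memLp_inner_smul u v w))
      simp only [LinearMap.coe_mk, AddHom.coe_mk, Submodule.coe_smul, Pi.smul_apply,
        real_inner_smul_left, mul_smul])
    (fun u v v' => LinearMap.ext fun w => by
      refine Eq.trans ?_ (l2Proj_add hD (memLp_inner_smul u v w) (memLp_inner_smul u v' w))
      simp only [LinearMap.coe_mk, AddHom.coe_mk, Submodule.coe_add, Pi.add_apply, inner_add_right,
        add_smul])
    (fun c u v => LinearMap.ext fun w => by
      refine Eq.trans ?_ (l2Proj_smul hD c (memLp_inner_smul u v w))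
      simp only [LinearMap.coe_mk, AddHom.coe_mk, Submodule.coe_smul, Pi.smul_apply,
        real_inner_smul_right, mul_smul])

lemma l2Form_discLap_comm (hD : IsOpen D) (v χ : Vh 𝒯 r) :
    l2Form 𝒯 r (discLap 𝒯 r v) χ = l2Form 𝒯 r (discLap 𝒯 r χ) v := by
  change l2 D _ _ = l2 D _ _
  rw [discLap_spec hD, discLap_spec hD, l2Grad_comm]

/-- The discrete Laplacian as a linear map. -/
def discLapLinear (𝒯 : Triangulation D) (r : ℕ) (hD : IsOpen D) : Vh 𝒯 r →ₗ[ℝ] Vh 𝒯 r where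
  toFun := discLap 𝒯 r
  map_add' u v := l2_injective hD fun χ => by
    change l2Form 𝒯 r _ χ = l2Form 𝒯 r _ χ
    rw [map_add, LinearMap.add_apply, l2Form_discLap_comm hD, map_add, l2Form_discLap_comm hD u,
      l2Form_discLap_comm hD v]
  map_smul' c u := l2_injective hD fun χ => by
    change l2Form 𝒯 r _ χ = l2Form 𝒯 r _ χ
    rw [RingHom.id_apply, map_smul, LinearMap.smul_apply, l2Form_discLap_comm hD, map_smul,
      l2Form_discLap_comm hD u]

/-- The linear map `u ↦ e (e · u)` of `V_h`. -/
def axisLinear (𝒯 : Triangulation D) (r : ℕ) (e : Eu 3) : Vh 𝒯 r →ₗ[ℝ] Vh 𝒯 r where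
  toFun u := ⟨fun x => inner ℝ e (u.1 x) • e,
    (continuousOn_const.inner (𝕜 := ℝ) u.2.1).fun_smul continuousOn_const,
    fun x hx => by simp [u.2.2.1 x hx], fun K hK => by
      obtain ⟨p, hp, hpe⟩ := u.2.2.2 K hK
      refine ⟨fun i => e i • ∑ j, e j • p j, fun i => ?_, fun x hx i => ?_⟩
      · exact (MvPolynomial.totalDegree_smul_le _ _).trans
          (MvPolynomial.totalDegree_finsetSum_le fun j _ =>
            (MvPolynomial.totalDegree_smul_le _ _).trans (hp j))
      · simp [PiLp.inner_apply, hpe x hx, mul_comm]⟩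
  map_add' u v := by
    ext1
    funext x
    simp [inner_add_right, add_smul]
  map_smul' c u := by
    ext1
    funext x
    simp [inner_smul_right, mul_smul]

/-- The discrete effective field as an element of `V_h`. -/
def effFieldVh (𝒯 : Triangulation D) (r : ℕ) (hD : IsOpen D) (e : Eu 3) (u : Vh 𝒯 r) : Vh 𝒯 r :=
  discLapLinear 𝒯 r hD u - (u + projTrilinear 𝒯 r hD u u u + axisLinear 𝒯 r e u)

lemma coe_effFieldVh (hD : IsOpen D) (e : Eu 3) (u : Vh 𝒯 r) :
    (effFieldVh 𝒯 r hD e u).1 = effField 𝒯 r e u := by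
  have h : projTrilinear 𝒯 r hD u u u = l2Proj 𝒯 r fun y => ‖u.1 y‖ ^ 2 • u.1 y := by
    simp_rw [← real_inner_self_eq_norm_sq]
    rfl
  funext x
  rw [effFieldVh, h]
  rfl

lemma continuous_cross : Continuous fun p : Eu 3 × Eu 3 => cross p.1 p.2 := by
  refine (PiLp.continuous_toLp 2 _).comp (continuous_pi fun i => ?_)
  fin_cases i <;> simp [cross_apply] <;> fun_prop

lemma cross_add_left (a b c : Eu 3) : cross (a + b) c = cross a c + cross b c := by
  simp [cross]

lemma cross_add_right (a b c : Eu 3) : cross a (b + c) = cross a b + cross a c := by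
  simp [cross]

lemma cross_smul_left (t : ℝ) (a b : Eu 3) : cross (t • a) b = t • cross a b := by
  simp [cross]

lemma cross_smul_right (t : ℝ) (a b : Eu 3) : cross a (t • b) = t • cross a b := by
  simp [cross]

lemma inner_cross_self (a b : Eu 3) : inner ℝ (cross a b) a = 0 := by
  simp [cross, PiLp.inner_apply, Fin.sum_univ_three, cross_apply]
  ring

lemma memLp_cross (u v : Vh 𝒯 r) :
    MemLp (fun x => cross (u.1 x) (v.1 x)) 2 (volume.restrict D) :=
  memLp_of_continuousOn 𝒯 2 (continuous_cross.comp_continuousOn (u.2.1.prodMk v.2.1))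

/-- The trilinear form `(u, v, χ) ↦ ⟨u × v, χ⟩`. -/
def crossForm (𝒯 : Triangulation D) (r : ℕ) :
    Vh 𝒯 r →ₗ[ℝ] Vh 𝒯 r →ₗ[ℝ] Module.Dual ℝ (Vh 𝒯 r) :=
  LinearMap.mk₂ ℝ (fun u v => l2Functional 𝒯 r (fun x => cross (u.1 x) (v.1 x)) (memLp_cross u v))
    (fun u u' v => LinearMap.ext fun χ => by
      refine Eq.trans ?_ (l2_add_left (memLp_cross u v) (memLp_cross u' v) (memLp_Vh χ 2))
      simp only [← cross_add_left]
      rfl)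
    (fun c u v => LinearMap.ext fun χ => by
      refine Eq.trans ?_ (l2_smul_left c (fun x => cross (u.1 x) (v.1 x)) χ.1)
      simp only [← cross_smul_left]
      rfl)
    (fun u v v' => LinearMap.ext fun χ => by
      refine Eq.trans ?_ (l2_add_left (memLp_cross u v) (memLp_cross u v') (memLp_Vh χ 2))
      simp only [← cross_add_right]
      rfl)
    (fun c u v => LinearMap.ext fun χ => by
      refine Eq.trans ?_ (l2_smul_left c (fun x => cross (u.1 x) (v.1 x)) χ.1)
      simp only [← cross_smul_right]
      rfl)

lemma crossForm_self (u v : Vh 𝒯 r) : crossForm 𝒯 r u v u = 0 := by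
  change l2 D (fun x => cross (u.1 x) (v.1 x)) u.1 = 0
  simp [l2, inner_cross_self]

lemma l2_self_nonneg (f : Eu d → Eu 3) : 0 ≤ l2 D f f :=
  integral_nonneg fun _ => real_inner_self_nonneg

/-- The effective field is dissipative. -/
lemma l2Form_effFieldVh_self_nonpos (hD : IsOpen D) (e : Eu 3) (u : Vh 𝒯 r) :
    l2Form 𝒯 r (effFieldVh 𝒯 r hD e u) u ≤ 0 := by
  have h1 : l2Form 𝒯 r (discLapLinear 𝒯 r hD u) u ≤ 0 := by
    change l2 D (discLap 𝒯 r u).1 u.1 ≤ 0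
    rw [discLap_spec hD]
    exact neg_nonpos.2 (integral_nonneg fun x => Finset.sum_nonneg fun i _ =>
      real_inner_self_nonneg)
  have h2 : 0 ≤ l2Form 𝒯 r u u := l2_self_nonneg u.1
  have h3 : 0 ≤ l2Form 𝒯 r (projTrilinear 𝒯 r hD u u u) u := by
    change 0 ≤ l2 D (l2Proj 𝒯 r fun x => inner ℝ (u.1 x) (u.1 x) • u.1 x).1 u.1
    rw [l2_l2Proj hD (memLp_inner_smul u u u)]
    refine integral_nonneg fun x => ?_
    change 0 ≤ inner ℝ (inner ℝ (u.1 x) (u.1 x) • u.1 x) (u.1 x)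
    rw [real_inner_smul_left]
    exact mul_self_nonneg _
  have h4 : 0 ≤ l2Form 𝒯 r (axisLinear 𝒯 r e u) u := by
    change 0 ≤ ∫ x in D, inner ℝ (inner ℝ e (u.1 x) • e) (u.1 x)
    refine integral_nonneg fun x => ?_
    change 0 ≤ inner ℝ (inner ℝ e (u.1 x) • e) (u.1 x)
    rw [real_inner_smul_left]
    exact mul_self_nonneg _
  rw [effFieldVh, map_sub, map_add, map_add]
  simp only [LinearMap.sub_apply, LinearMap.add_apply]
  linarith

lemma WeaklyContDiff.effFieldVh {E : Type*} [NormedAddCommGroup E] [NormedSpace ℝ E] (hD : IsOpen D)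
    (e : Eu 3) {G : E → Vh 𝒯 r} (hG : WeaklyContDiff G) :
    WeaklyContDiff fun c => LLB.effFieldVh 𝒯 r hD e (G c) := by
  refine (hG.map (discLapLinear 𝒯 r hD)).sub ((hG.add ?_).add (hG.map (axisLinear 𝒯 r e)))
  have h2 : WeaklyContDiff fun c => projTrilinear 𝒯 r hD (G c) (G c) :=
    hG.map₂ (U := Vh 𝒯 r →ₗ[ℝ] Vh 𝒯 r) (projTrilinear 𝒯 r hD) hG
  exact h2.map₂ (V := Vh 𝒯 r →ₗ[ℝ] Vh 𝒯 r) LinearMap.id hG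

lemma memLp_advect {b : Eu d → Eu d} {C : ℝ} (hb : AEStronglyMeasurable b (volume.restrict D))
    (hbC : ∀ᵐ x ∂(volume.restrict D), ‖b x‖ ≤ C) (v : Vh 𝒯 r) :
    MemLp (advect b v.1) 2 (volume.restrict D) := by
  refine memLp_finsetSum _ fun i _ => ?_
  refine (memLp_pd v i 2).of_le_mul (c := C) ?_ ?_
  · exact ((EuclideanSpace.proj i).continuous.comp_aestronglyMeasurable hb).smul (memLp_pd v i 2).1
  · filter_upwards [hbC] with x hx
    rw [norm_smul]
    exact mul_le_mul_of_nonneg_right ((PiLp.norm_apply_le (b x) i).trans hx) (norm_nonneg _)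

end DiscreteOperators

end LLB

end
theorem lemma5p3 {d : ℕ} (hd1 : 1 ≤ d) (hd3 : d ≤ 3)
    (D : Set (LLB.Eu d)) (hDopen : IsOpen D)
    (𝒯 : LLB.Triangulation D) (r : ℕ) (hr : 1 ≤ r)
    (e : LLB.Eu 3) (he : ‖e‖ = 1)
    (α β₁ : ℝ) (hα : 0 < α)
    (k : ℝ) (hk : 0 < k) (n : ℕ) (hn : 1 ≤ n)
    (ν : ℝ → LLB.Eu d → LLB.Eu d) (νbd : ℝ)
    (hνmeas : AEStronglyMeasurable (ν (n * k)) (volume.restrict D))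
    (hνbd : ∀ᵐ x ∂(volume.restrict D), ‖ν (n * k) x‖ ≤ νbd)
    (uprev : LLB.Vh 𝒯 r) :
    ∃ u : LLB.Vh 𝒯 r, LLB.SolvesStep 𝒯 r e α β₁ k (ν (n * k)) uprev u := by
  let q := LLB.l2Form 𝒯 r
  let H := LLB.effFieldVh 𝒯 r hDopen e
  let A := LLB.l2Functional 𝒯 r _ (LLB.memLp_advect hνmeas hνbd uprev)
  let T : LLB.Vh 𝒯 r → Module.Dual ℝ (LLB.Vh 𝒯 r) := fun u =>
    k⁻¹ • q u + LLB.crossForm 𝒯 r u (H u) - α • q (H u) - (k⁻¹ • q uprev + β₁ • A)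
  have hT : ∀ (m : ℕ) (Φ : EuclideanSpace ℝ (Fin m) →ₗ[ℝ] LLB.Vh 𝒯 r),
      LLB.WeaklyContDiff fun c => T (Φ c) := by
    intro m Φ
    have hΦ := LLB.weaklyContDiff_linearMap Φ
    have hH := hΦ.effFieldVh hDopen e
    exact (((hΦ.map (k⁻¹ • q)).add (hΦ.map₂ (LLB.crossForm 𝒯 r) hH)).sub
      (hH.map (α • q))).sub (LLB.WeaklyContDiff.const _)
  have hq : ∀ v, v ≠ 0 → 0 < (k⁻¹ • q) v v := by
    intro v hv
    refine mul_pos (inv_pos.2 hk) (lt_of_le_of_ne (LLB.l2_self_nonneg v.1) fun h => hv ?_)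
    exact LLB.eq_zero_of_l2_self hDopen v h.symm
  have hcoer : ∀ v, (k⁻¹ • q) v v - (k⁻¹ • q uprev + β₁ • A) v ≤ T v v := by
    intro v
    have h1 := LLB.crossForm_self v (H v)
    have h2 := mul_nonpos_of_nonneg_of_nonpos hα.le
      (LLB.l2Form_effFieldVh_self_nonpos hDopen e v)
    simp only [T, LinearMap.sub_apply, LinearMap.add_apply, LinearMap.smul_apply, smul_eq_mul]
    rw [h1]
    linarith
  obtain ⟨u, hu⟩ := LLB.exists_zero_of_coercive T hT (k⁻¹ • q) hq _ hcoer
  refine ⟨u, fun χ => ?_⟩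
  have h := LinearMap.congr_fun hu χ
  have h1 : LLB.l2 D (fun x => k⁻¹ • (u.1 x - uprev.1 x)) χ.1 = k⁻¹ * (q u χ - q uprev χ) := by
    rw [LLB.l2_smul_left, LLB.l2_sub_left (LLB.memLp_Vh u 2) (LLB.memLp_Vh uprev 2)
      (LLB.memLp_Vh χ 2)]
    rfl
  have h2 : LLB.l2 D (fun x => LLB.cross (u.1 x) (LLB.effField 𝒯 r e u x)) χ.1 =
      LLB.crossForm 𝒯 r u (H u) χ := by
    rw [← LLB.coe_effFieldVh hDopen]
    rfl
  have h3 : LLB.l2 D (LLB.effField 𝒯 r e u) χ.1 = q (H u) χ := by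
    rw [← LLB.coe_effFieldVh hDopen]
    rfl
  have h4 : LLB.l2 D (LLB.advect (ν (n * k)) uprev.1) χ.1 = A χ := rfl
  rw [h1, h2, h3, h4]
  simp only [T, LinearMap.sub_apply, LinearMap.add_apply, LinearMap.smul_apply, smul_eq_mul,
    LinearMap.zero_apply] at h
  linarith
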